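/- Let $\varphi_0\colon\mathbb R^n\to\mathbb R$ and $\Phi\colon\mathbb R^n\to\mathbb R^m$ be $\mathcal C^2$-smooth around $\bar x\in\mathbb R^n$, and let $\theta\colon\mathbb R^m\to(-\infty,\infty]$ be convex piecewise linear ($\theta\in CPWL$), i.e., its epigraph is a convex polyhedron (a finite intersection of closed half-spaces). Let $\partial\theta$ be the subdifferential of convex analysis (empty outside $\operatorname{dom}\theta$), let $L(x,v):=\varphi_0(x)+\langle\Phi(x),v\rangle$, and define the KKT solution map $S_{KKT}\colon\mathbb R^n\times\mathbb R^m\rightrightarrows\mathbb R^n\times\mathbb R^m$ by $$S_{KKT}(p_1,p_2):=\{(x,v)\mid p_1=\nabla_xL(x,v),\ v\in\partial\theta(p_2+\Phi(x))\}.$$ Let $(\bar x,\bar v)\in S_{KKT}(0,0)$ and $\bar z:=\Phi(\bar x)$. A set-valued mapping $F$ between Euclidean spaces is Lipschitz-like (has the Aubin property) around $(x_0,y_0)\in\operatorname{gph}F$ if there are neighborhoods $U$ of $x_0$ and $V$ of $y_0$ and a number $\ell\ge0$ such that $F(x_1)\cap V\subset F(x_2)+\ell\|x_1-x_2\|\mathbb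 B$ for all $x_1,x_2\in U$, where $\mathbb B$ is the closed unit ball. The regular normal cone to a set $\Omega$ at $z\in\Omega$ is $$\widehat N(z;\Omega):=\Big\{v\ \Big|\ \limsup_{u\to z,\,u\in\Omega}\frac{\langle v,u-z\rangle}{\|u-z\|}\le0\Big\};$$ the limiting normal cone $N(\bar z;\Omega)$ at $\bar z\in\Omega$ consists of all limits $v=\lim_k v_k$ with $v_k\in\widehat N(z_k;\Omega)$, $z_k\in\Omega$, $z_k\to\bar z$; and the limiting coderivative of $F$ at $(\bar x,\bar y)\in\operatorname{gph}F$ is $D^*F(\bar x,\bar y)(v):=\{u\mid(u,-v)\in N((\bar x,\bar y);\operatorname{gph}F)\}$. Then $S_{KKT}$ is Lipschitz-like around $((0,0),(\bar x,\bar v))$ if and only if, for all $\xi\in\mathbb R^n$ and $\eta\in\mathbb R^m$, $$\left\{\begin{array}{l}\nabla^2_{xx}L(\bar x,\bar v)\xi+\nabla\Phi(\bar x)^*\eta=0,\\ \eta\in(D^*\partial\theta)(\bar z,\bar v)\big(\nabla\Phi(\bar x)\xi\big)\end{array}\right.\ \Longrightarrow\ (\xi,\eta)=(0,0).$$ -/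

import Mathlib

open Set Filter Topology

namespace VariationalSystems

/-- A convex polyhedron: the intersection of finitely many closed half-spaces. -/
def IsPolyhedron {E : Type*} [NormedAddCommGroup E] [InnerProductSpace ℝ E] (C : Set E) : Prop :=
  ∃ (k : ℕ) (a : Fin k → E) (b : Fin k → ℝ), C = {x | ∀ i, inner ℝ (a i) x ≤ b i}

/-- The epigraph of an extended-real-valued function, as a subset of the Euclidean product
`E × ℝ`. -/
def epi {E : Type*} (θ : E → EReal) : Set (WithLp 2 (E × ℝ)) :=
  {p | θ p.fst ≤ (p.snd : EReal)}

/-- The class CPWL of convex piecewise linear functions with values in `(-∞, ∞]`: those whose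
epigraph is a convex polyhedron. -/
def IsCPWL {E : Type*} [NormedAddCommGroup E] [InnerProductSpace ℝ E] (θ : E → EReal) : Prop :=
  (∀ z, θ z ≠ ⊥) ∧ IsPolyhedron (epi θ)

/-- The subdifferential of convex analysis; it is empty outside the domain of `θ`. -/
def subdiff {E : Type*} [NormedAddCommGroup E] [InnerProductSpace ℝ E] (θ : E → EReal) (z : E) :
    Set E :=
  {v | θ z < ⊤ ∧ ∀ u, θ z + ((inner ℝ v (u - z) : ℝ) : EReal) ≤ θ u}

/-- The Fréchet (regular) normal cone to `Ω` at a point `z` of `Ω`: all `v` with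
`limsup ⟪v, u - z⟫ / ‖u - z‖ ≤ 0` as `u → z` within `Ω`. -/
def regularNormalCone {E : Type*} [NormedAddCommGroup E] [InnerProductSpace ℝ E]
    (z : E) (Ω : Set E) : Set E :=
  {v | ∀ ε > (0 : ℝ), ∀ᶠ u in 𝓝[Ω] z, inner ℝ v (u - z) ≤ ε * ‖u - z‖}

/-- The Mordukhovich (limiting) normal cone. -/
def limitingNormalCone {E : Type*} [NormedAddCommGroup E] [InnerProductSpace ℝ E]
    (z : E) (Ω : Set E) : Set E :=
  {v | ∃ (zs vs : ℕ → E), (∀ k, zs k ∈ Ω) ∧ Tendsto zs atTop (𝓝 z) ∧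
    (∀ k, vs k ∈ regularNormalCone (zs k) Ω) ∧ Tendsto vs atTop (𝓝 v)}

/-- The graph of a set-valued mapping, in the Euclidean product space. -/
def gph {X Y : Type*} (F : X → Set Y) : Set (WithLp 2 (X × Y)) :=
  {p | p.snd ∈ F p.fst}

/-- The limiting coderivative `D^*F(x, y)(v)`. -/
def coderivative {X Y : Type*} [NormedAddCommGroup X] [InnerProductSpace ℝ X]
    [NormedAddCommGroup Y] [InnerProductSpace ℝ Y] (F : X → Set Y) (x : X) (y : Y) (v : Y) :
    Set X :=
  {u | WithLp.toLp 2 (u, -v) ∈ limitingNormalCone (WithLp.toLp 2 (x, y)) (gph F)}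

/-- The Lipschitz-like (Aubin, pseudo-Lipschitz) property of `F` around a point `(x₀, y₀)` of its
graph: `F x₁ ∩ V ⊆ F x₂ + ℓ ‖x₁ - x₂‖ 𝔹` for all `x₁, x₂ ∈ U`, with `𝔹` the closed unit ball. -/
def LipschitzLike {X Y : Type*} [NormedAddCommGroup X] [NormedAddCommGroup Y]
    (F : X → Set Y) (x₀ : X) (y₀ : Y) : Prop :=
  ∃ U ∈ 𝓝 x₀, ∃ V ∈ 𝓝 y₀, ∃ ℓ ≥ (0 : ℝ), ∀ x₁ ∈ U, ∀ x₂ ∈ U, ∀ y₁ ∈ F x₁ ∩ V,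
    ∃ y₂ ∈ F x₂, ‖y₁ - y₂‖ ≤ ℓ * ‖x₁ - x₂‖

/-- The Lagrangian `L(x, v) = φ₀(x) + ⟪Φ(x), v⟫`. -/
noncomputable def lagrangian {n m : ℕ} (φ₀ : EuclideanSpace ℝ (Fin n) → ℝ)
    (Φ : EuclideanSpace ℝ (Fin n) → EuclideanSpace ℝ (Fin m))
    (x : EuclideanSpace ℝ (Fin n)) (v : EuclideanSpace ℝ (Fin m)) : ℝ :=
  φ₀ x + inner ℝ (Φ x) v

/-- The Hessian `∇²ₓₓL(x, v)` of the Lagrangian in the first variable, as the derivative at `x` of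
the partial gradient `∇ₓL(·, v)`. -/
noncomputable def hessianXX {n m : ℕ} (φ₀ : EuclideanSpace ℝ (Fin n) → ℝ)
    (Φ : EuclideanSpace ℝ (Fin n) → EuclideanSpace ℝ (Fin m))
    (x : EuclideanSpace ℝ (Fin n)) (v : EuclideanSpace ℝ (Fin m)) :
    EuclideanSpace ℝ (Fin n) →L[ℝ] EuclideanSpace ℝ (Fin n) :=
  fderiv ℝ (fun x' => gradient (fun x'' => lagrangian φ₀ Φ x'' v) x') x

/-- The KKT solution map
`(p₁, p₂) ↦ {(x, v) | p₁ = ∇ₓL(x, v), v ∈ ∂θ(p₂ + Φ(x))}`; the gradient equation includes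
that the gradient exists. -/
def kktSolutionMap {n m : ℕ} (φ₀ : EuclideanSpace ℝ (Fin n) → ℝ)
    (Φ : EuclideanSpace ℝ (Fin n) → EuclideanSpace ℝ (Fin m))
    (θ : EuclideanSpace ℝ (Fin m) → EReal)
    (p : WithLp 2 (EuclideanSpace ℝ (Fin n) × EuclideanSpace ℝ (Fin m))) :
    Set (WithLp 2 (EuclideanSpace ℝ (Fin n) × EuclideanSpace ℝ (Fin m))) :=
  {q | HasGradientAt (fun x => lagrangian φ₀ Φ x q.snd) p.fst q.fst ∧
    q.snd ∈ subdiff θ (p.snd + Φ q.fst)}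

end VariationalSystems

open VariationalSystems

/-! Two facts combine. The Mordukhovich criterion: in finite dimensions, a map `F` with locally
closed graph is Lipschitz-like at a point of its graph iff `D^*F(0) = {0}` there
(`coderivative_zero_of_lipschitzLike`, `lipschitzLike_of_coderivative_zero`). Exact coderivative
calculus (`mem_coderivative_iff_of_solvesSystem`): with `K = ∇ₓL`, the graph of `S_KKT` is locally
the preimage of `{0} × gph ∂θ` under `(p₁, p₂, x, v) ↦ (p₁ - K(x, v), p₂ + Φ(x), v)`, a `C¹` map
with surjective derivative, so normals correspond exactly.

Hence `(a, b) ∈ D^*S(0)` iff `K_x^* a = ∇Φ^* b` and `(b, K_v^* a)` is normal to `gph ∂θ`. Here `K_x`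
is the Hessian, which is symmetric, and `K_v = ∇Φ^*`. Putting `ξ = -a`, `η = b` gives the stated
system. Membership of `θ` in CPWL enters through closedness of `gph ∂θ`. -/

namespace VariationalSystems

/-! ### Calculus of regular normals -/

section RegularNormals

variable {E F : Type*} [NormedAddCommGroup E] [InnerProductSpace ℝ E]
  [NormedAddCommGroup F] [InnerProductSpace ℝ F]

theorem mem_regularNormalCone_of_isLocalMinOn {z : E} {Ω : Set E} {g : E → ℝ} {g' : E →L[ℝ] ℝ}
    {w : E} (hg : HasFDerivAt g g' z) (hmin : IsLocalMinOn g Ω z)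
    (hw : ∀ h, inner ℝ w h = -g' h) : w ∈ regularNormalCone z Ω := by
  intro ε hε
  have h1 : ∀ᶠ u in 𝓝[Ω] z, ‖g u - g z - g' (u - z)‖ ≤ ε * ‖u - z‖ :=
    (hg.isLittleO.def hε).filter_mono nhdsWithin_le_nhds
  filter_upwards [h1, hmin] with u hu hm
  rw [hw]
  rw [Real.norm_eq_abs] at hu
  have := (abs_le.1 hu).2
  linarith

/-- Adjoint derivatives pull normals back along any differentiable map carrying `Ω` into `Ω'`; no
surjectivity is needed. Both directions of the graph calculus follow by choosing suitable maps. -/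
theorem mem_regularNormalCone_of_hasFDerivAt {g : E → F} {A : E →L[ℝ] F} {z : E} {Ω : Set E}
    {Ω' : Set F} {v : F} {w : E} (hg : HasFDerivAt g A z) (hmaps : ∀ᶠ u in 𝓝[Ω] z, g u ∈ Ω')
    (hv : v ∈ regularNormalCone (g z) Ω') (hw : ∀ h, inner ℝ w h = inner ℝ v (A h)) :
    w ∈ regularNormalCone z Ω := by
  intro ε hε
  have hC : 0 < ‖A‖ + 1 := by positivity
  have hV : 0 < ‖v‖ + 1 := by positivity
  have ht : Tendsto g (𝓝[Ω] z) (𝓝[Ω'] (g z)) :=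
    tendsto_nhdsWithin_iff.2 ⟨hg.continuousAt.tendsto.mono_left nhdsWithin_le_nhds, hmaps⟩
  -- The two tolerances are tuned so that the normality of `v` and the linearization error cost `ε /
  -- 2` each.
  have h1 := ht.eventually (hv (ε / (2 * (‖A‖ + 1))) (by positivity))
  have h2 : ∀ᶠ u in 𝓝[Ω] z, ‖g u - g z - A (u - z)‖ ≤ ε / (2 * (‖v‖ + 1)) * ‖u - z‖ :=
    (hg.isLittleO.def (by positivity)).filter_mono nhdsWithin_le_nhds
  have h3 : ∀ᶠ u in 𝓝[Ω] z, ‖g u - g z - A (u - z)‖ ≤ 1 * ‖u - z‖ :=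
    (hg.isLittleO.def one_pos).filter_mono nhdsWithin_le_nhds
  filter_upwards [h1, h2, h3] with u h1 h2 h3
  have h4 : ‖g u - g z‖ ≤ (‖A‖ + 1) * ‖u - z‖ := by
    have := norm_add_le (g u - g z - A (u - z)) (A (u - z))
    rw [sub_add_cancel] at this
    linarith [A.le_opNorm (u - z)]
  have h5 : inner ℝ v (A (u - z)) = inner ℝ v (g u - g z) - inner ℝ v (g u - g z - A (u - z)) := by
    rw [← inner_sub_right, sub_sub_cancel]
  have h6 : -inner ℝ v (g u - g z - A (u - z)) ≤ (‖v‖ + 1) * (ε / (2 * (‖v‖ + 1)) * ‖u - z‖) := by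
    refine (neg_le_abs _).trans ((abs_real_inner_le_norm _ _).trans ?_)
    exact mul_le_mul (by linarith) h2 (norm_nonneg _) hV.le
  have h7 : (‖v‖ + 1) * (ε / (2 * (‖v‖ + 1)) * ‖u - z‖) = ε / 2 * ‖u - z‖ := by field_simp
  have h8 : ε / (2 * (‖A‖ + 1)) * ‖g u - g z‖ ≤ ε / 2 * ‖u - z‖ := by
    calc ε / (2 * (‖A‖ + 1)) * ‖g u - g z‖
        ≤ ε / (2 * (‖A‖ + 1)) * ((‖A‖ + 1) * ‖u - z‖) := by gcongr
      _ = ε / 2 * ‖u - z‖ := by field_simp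
  rw [hw, h5]
  linarith

theorem add_mem_regularNormalCone {z v w : E} {Ω : Set E} (hv : v ∈ regularNormalCone z Ω)
    (hw : w ∈ regularNormalCone z Ω) : v + w ∈ regularNormalCone z Ω := by
  intro ε hε
  filter_upwards [hv (ε / 2) (by positivity), hw (ε / 2) (by positivity)] with u h1 h2
  rw [inner_add_left]
  linarith

theorem smul_mem_regularNormalCone {z v : E} {Ω : Set E} {t : ℝ} (ht : 0 < t)
    (hv : v ∈ regularNormalCone z Ω) : t • v ∈ regularNormalCone z Ω := by
  intro ε hε
  filter_upwards [hv (ε / t) (by positivity)] with u h1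
  rw [real_inner_smul_left]
  calc t * inner ℝ v (u - z) ≤ t * (ε / t * ‖u - z‖) := by gcongr
    _ = ε * ‖u - z‖ := by field_simp

theorem eq_zero_of_mem_regularNormalCone {z v : E} {Ω : Set E} (hΩ : Ω ∈ 𝓝 z)
    (hv : v ∈ regularNormalCone z Ω) : v = 0 := by
  by_contra hne
  have hpos : 0 < ‖v‖ := norm_pos_iff.2 hne
  have h := hv (‖v‖ / 2) (by positivity)
  rw [nhdsWithin_eq_nhds.2 hΩ] at h
  have ht : Tendsto (fun t : ℝ => z + t • v) (𝓝[>] 0) (𝓝 z) := by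
    have : Continuous (fun t : ℝ => z + t • v) := by fun_prop
    simpa using (this.tendsto 0).mono_left (nhdsWithin_le_nhds (s := Ioi 0))
  obtain ⟨t, h1, h2⟩ := ((ht.eventually h).and self_mem_nhdsWithin).exists
  have h2 : 0 < t := h2
  rw [add_sub_cancel_left, real_inner_smul_right, real_inner_self_eq_norm_sq, norm_smul,
    Real.norm_of_nonneg h2.le] at h1
  nlinarith [mul_pos h2 (pow_pos hpos 2)]

theorem mem_regularNormalCone_singleton (z v : E) : v ∈ regularNormalCone z {z} := by
  intro ε hε
  filter_upwards [self_mem_nhdsWithin] with u hu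
  rw [mem_singleton_iff.1 hu]
  simp

theorem limitingNormalCone_of_tendsto {z v : E} {Ω : Set E} {zs vs : ℕ → E}
    (h : ∀ᶠ k in atTop, zs k ∈ Ω ∧ vs k ∈ regularNormalCone (zs k) Ω)
    (hz : Tendsto zs atTop (𝓝 z)) (hv : Tendsto vs atTop (𝓝 v)) :
    v ∈ limitingNormalCone z Ω := by
  obtain ⟨N, hN⟩ := eventually_atTop.1 h
  exact ⟨fun k => zs (k + N), fun k => vs (k + N), fun k => (hN _ (by omega)).1,
    (tendsto_add_atTop_iff_nat N).2 hz, fun k => (hN _ (by omega)).2,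
    (tendsto_add_atTop_iff_nat N).2 hv⟩

end RegularNormals

/-! ### Norms and limits in Euclidean products -/

theorem norm_le_norm_fst_add_norm_snd {X Y : Type*} [NormedAddCommGroup X] [NormedAddCommGroup Y]
    (p : WithLp 2 (X × Y)) : ‖p‖ ≤ ‖p.fst‖ + ‖p.snd‖ := by
  refine le_of_sq_le_sq ?_ (by positivity)
  rw [WithLp.prod_norm_sq_eq_of_L2]
  nlinarith [norm_nonneg p.fst, norm_nonneg p.snd]

section ProductLimits

variable {X Y : Type*} [NormedAddCommGroup X] [NormedAddCommGroup Y] {q : ℕ → WithLp 2 (X × Y)}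
  {p : WithLp 2 (X × Y)}

theorem tendsto_withLp_fst (h : Tendsto q atTop (𝓝 p)) :
    Tendsto (fun k => (q k).fst) atTop (𝓝 p.fst) :=
  ((WithLp.continuous_fst 2 X Y).tendsto p).comp h

theorem tendsto_withLp_snd (h : Tendsto q atTop (𝓝 p)) :
    Tendsto (fun k => (q k).snd) atTop (𝓝 p.snd) :=
  ((WithLp.continuous_snd 2 X Y).tendsto p).comp h

theorem tendsto_toLp_prodMk {f : ℕ → X} {g : ℕ → Y} {x : X} {y : Y}
    (hf : Tendsto f atTop (𝓝 x)) (hg : Tendsto g atTop (𝓝 y)) :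
    Tendsto (fun k => WithLp.toLp 2 (f k, g k)) atTop (𝓝 (WithLp.toLp 2 (x, y))) :=
  ((WithLp.prod_continuous_toLp 2 X Y).tendsto (x, y)).comp (hf.prodMk_nhds hg)

end ProductLimits

/-! ### The Mordukhovich criterion -/

section Criterion

variable {X Y : Type*} [NormedAddCommGroup X] [InnerProductSpace ℝ X]
  [NormedAddCommGroup Y] [InnerProductSpace ℝ Y]

/-- Under the Aubin property with modulus `ℓ`, regular normals to the graph near the reference point
satisfy `‖u‖ ≤ ℓ ‖v‖`. -/
theorem norm_fst_le_of_lipschitz {F : X → Set Y} {U : Set X} {V : Set Y} {ℓ : ℝ} (hℓ : 0 ≤ ℓ)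
    (hF : ∀ x₁ ∈ U, ∀ x₂ ∈ U, ∀ y₁ ∈ F x₁ ∩ V, ∃ y₂ ∈ F x₂, ‖y₁ - y₂‖ ≤ ℓ * ‖x₁ - x₂‖)
    {z w : WithLp 2 (X × Y)} (hz : z ∈ gph F) (hU : U ∈ 𝓝 z.fst) (hV : z.snd ∈ V)
    (hw : w ∈ regularNormalCone z (gph F)) : ‖w.fst‖ ≤ ℓ * ‖w.snd‖ := by
  by_cases hu0 : w.fst = 0
  · rw [hu0, norm_zero]; positivity
  have hupos : 0 < ‖w.fst‖ := norm_pos_iff.2 hu0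
  refine le_of_forall_pos_le_add fun δ hδ => ?_
  -- Moving the argument along `t • w.fst`, the Aubin property supplies graph points displaced by at
  -- most `(1 + ℓ) * t * ‖w.fst‖`. Testing `w` on them and dividing by `t * ‖w.fst‖` leaves an error
  -- `δ`.
  have hε : 0 < δ / (1 + ℓ) := by positivity
  have htx : Tendsto (fun t : ℝ => z.fst + t • w.fst) (𝓝[>] 0) (𝓝 z.fst) := by
    have : Continuous (fun t : ℝ => z.fst + t • w.fst) := by fun_prop
    simpa using (this.tendsto 0).mono_left (nhdsWithin_le_nhds (s := Ioi 0))
  have hex : ∀ t : ℝ, ∃ y : Y, z.fst + t • w.fst ∈ U →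
      y ∈ F (z.fst + t • w.fst) ∧ ‖z.snd - y‖ ≤ ℓ * ‖t • w.fst‖ := by
    intro t
    by_cases h : z.fst + t • w.fst ∈ U
    · obtain ⟨y, hy, hy'⟩ := hF _ (mem_of_mem_nhds hU) _ h z.snd ⟨hz, hV⟩
      exact ⟨y, fun _ => ⟨hy, by simpa using hy'⟩⟩
    · exact ⟨0, fun h' => absurd h' h⟩
  choose y hy using hex
  have hev : ∀ᶠ t in 𝓝[>] (0 : ℝ), z.fst + t • w.fst ∈ U := htx.eventually hU
  have hty : Tendsto y (𝓝[>] 0) (𝓝 z.snd) := by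
    rw [tendsto_iff_norm_sub_tendsto_zero]
    have hlim : Tendsto (fun t : ℝ => ℓ * ‖t • w.fst‖) (𝓝[>] 0) (𝓝 0) := by
      have : Continuous (fun t : ℝ => ℓ * ‖t • w.fst‖) := by fun_prop
      simpa using (this.tendsto 0).mono_left (nhdsWithin_le_nhds (s := Ioi 0))
    refine squeeze_zero' (Eventually.of_forall fun _ => norm_nonneg _) ?_ hlim
    filter_upwards [hev] with t ht
    rw [norm_sub_rev]
    exact (hy t ht).2
  have ht : Tendsto (fun t => WithLp.toLp 2 (z.fst + t • w.fst, y t)) (𝓝[>] 0)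
      (𝓝[gph F] z) := by
    refine tendsto_nhdsWithin_iff.2 ⟨?_, ?_⟩
    · exact ((WithLp.prod_continuous_toLp 2 X Y).tendsto (z.fst, z.snd)).comp
        (htx.prodMk_nhds hty)
    · filter_upwards [hev] with t ht using (hy t ht).1
  obtain ⟨t, ⟨h1, h2⟩, h3⟩ := (((ht.eventually (hw _ hε)).and hev).and self_mem_nhdsWithin).exists
  have h3 : 0 < t := h3
  have hb := (hy t h2).2
  have hn : ‖t • w.fst‖ = t * ‖w.fst‖ := by rw [norm_smul, Real.norm_of_nonneg h3.le]
  have h4 := norm_le_norm_fst_add_norm_snd (WithLp.toLp 2 (z.fst + t • w.fst, y t) - z)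
  rw [WithLp.prod_inner_apply] at h1
  simp only [WithLp.ofLp_fst, WithLp.ofLp_snd, WithLp.sub_fst, WithLp.sub_snd, WithLp.toLp_fst,
    WithLp.toLp_snd, add_sub_cancel_left, real_inner_smul_right,
    real_inner_self_eq_norm_sq] at h1 h4
  rw [norm_sub_rev] at hb
  rw [hn] at hb h4
  have h5 : -inner ℝ w.snd (y t - z.snd) ≤ ‖w.snd‖ * (ℓ * (t * ‖w.fst‖)) :=
    (neg_le_abs _).trans ((abs_real_inner_le_norm _ _).trans (by gcongr))
  have h6 : δ / (1 + ℓ) * ‖WithLp.toLp 2 (z.fst + t • w.fst, y t) - z‖ ≤ δ * (t * ‖w.fst‖) := by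
    calc _ ≤ δ / (1 + ℓ) * (t * ‖w.fst‖ + ℓ * (t * ‖w.fst‖)) := by gcongr; linarith
      _ = δ * (t * ‖w.fst‖) := by field_simp
  have h7 : t * ‖w.fst‖ * ‖w.fst‖ ≤ t * ‖w.fst‖ * (ℓ * ‖w.snd‖ + δ) := by nlinarith
  exact le_of_mul_le_mul_left h7 (by positivity)

/-- The bound on regular normals is uniform near the reference point, so it survives the limit,
where the second component is zero. -/
theorem coderivative_zero_of_lipschitzLike {F : X → Set Y} {x₀ : X} {y₀ : Y}
    (hF : LipschitzLike F x₀ y₀) {u : X} (hu : u ∈ coderivative F x₀ y₀ 0) : u = 0 := by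
  obtain ⟨U, hU, V, hV, ℓ, hℓ, hF⟩ := hF
  obtain ⟨zs, ws, hz, hzt, hw, hwt⟩ := hu
  have hev : ∀ᶠ k in atTop, ‖(ws k).fst‖ ≤ ℓ * ‖(ws k).snd‖ := by
    filter_upwards [(tendsto_withLp_fst hzt).eventually (eventually_mem_nhds_iff.2 hU), (tendsto_withLp_snd hzt).eventually hV]
      with k h1 h2
    exact norm_fst_le_of_lipschitz hℓ hF (hz k) h1 h2 (hw k)
  have := le_of_tendsto_of_tendsto (tendsto_withLp_fst hwt).norm ((tendsto_withLp_snd hwt).norm.const_mul ℓ) hev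
  simpa using this

/-- Compactness: if no uniform bound held, violating normals rescaled to unit first component would
have second components tending to `0`, and a cluster point would be a unit vector in `D^*F(0)`. -/
theorem exists_norm_fst_le_of_coderivative [FiniteDimensional ℝ X] [FiniteDimensional ℝ Y]
    {F : X → Set Y} {x₀ : X} {y₀ : Y} (hD : ∀ u ∈ coderivative F x₀ y₀ 0, u = 0) :
    ∃ κ > (0 : ℝ), ∃ δ > (0 : ℝ), ∀ z ∈ gph F, dist z (WithLp.toLp 2 (x₀, y₀)) < δ →
      ∀ w ∈ regularNormalCone z (gph F), ‖w.fst‖ ≤ κ * ‖w.snd‖ := by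
  by_contra! hcon
  have hcon' : ∀ k : ℕ, ∃ z ∈ gph F, dist z (WithLp.toLp 2 (x₀, y₀)) < 1 / ((k : ℝ) + 1) ∧
      ∃ w ∈ regularNormalCone z (gph F), ((k : ℝ) + 1) * ‖w.snd‖ < ‖w.fst‖ := fun k =>
    hcon ((k : ℝ) + 1) (by positivity) _ (by positivity)
  choose z hz hzd w hw hwn using hcon'
  have hpos : ∀ k, 0 < ‖(w k).fst‖ := fun k => lt_of_le_of_lt (by positivity) (hwn k)
  set s : ℕ → WithLp 2 (X × Y) := fun k => ‖(w k).fst‖⁻¹ • w k with hs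
  have hs1 : ∀ k, ‖(s k).fst‖ = 1 := by
    intro k
    have := (hpos k).ne'
    simp [hs, norm_smul, this]
  have hs2 : ∀ k, ‖(s k).snd‖ ≤ 1 / ((k : ℝ) + 1) := by
    intro k
    have h := hpos k
    simp only [hs, WithLp.smul_snd, norm_smul, norm_inv, norm_norm]
    rw [inv_mul_le_iff₀ h, mul_one_div, le_div_iff₀ (by positivity)]
    linarith [hwn k]
  have hcpt : IsCompact (Metric.closedBall (0 : X) 1) := by
    have := FiniteDimensional.proper ℝ X
    exact isCompact_closedBall _ _
  obtain ⟨u, -, φ, hφ, hlim⟩ := hcpt.tendsto_subseq (x := fun k => (s k).fst)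
    (fun k => by simp [hs1])
  have h0 := tendsto_one_div_add_atTop_nhds_zero_nat (𝕜 := ℝ)
  have hsnd : Tendsto (fun k => (s k).snd) atTop (𝓝 0) :=
    squeeze_zero_norm hs2 h0
  have hzt : Tendsto z atTop (𝓝 (WithLp.toLp 2 (x₀, y₀))) := by
    rw [tendsto_iff_dist_tendsto_zero]
    exact squeeze_zero (fun _ => dist_nonneg) (fun k => (hzd k).le) h0
  have hu : u = 0 := by
    refine hD u ⟨z ∘ φ, s ∘ φ, fun k => hz _, hzt.comp hφ.tendsto_atTop, fun k =>
      smul_mem_regularNormalCone (inv_pos.2 (hpos _)) (hw _), ?_⟩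
    rw [neg_zero]
    exact ((WithLp.prod_continuous_toLp 2 X Y).tendsto (u, 0)).comp
      (hlim.prodMk_nhds (hsnd.comp hφ.tendsto_atTop))
  have h1 : ‖u‖ = 1 := tendsto_nhds_unique hlim.norm (by simp [hs1])
  rw [hu, norm_zero] at h1
  exact zero_ne_one h1

/-- If `‖· - x₂‖ + a ‖· - y₁‖ ^ 2` has a local minimum over the graph at a point off the fibre of
`x₂`, then it produces a regular normal with unit first component. -/
theorem regularNormal_of_isLocalMinOn {Ω : Set (WithLp 2 (X × Y))} {z : WithLp 2 (X × Y)} {x₂ : X}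
    {y₁ : Y} {a : ℝ} (hne : z.fst ≠ x₂)
    (hmin : IsLocalMinOn (fun p : WithLp 2 (X × Y) => ‖p.fst - x₂‖ + a * ‖p.snd - y₁‖ ^ 2) Ω z) :
    WithLp.toLp 2 (-(‖z.fst - x₂‖⁻¹ • (z.fst - x₂)), -((2 * a) • (z.snd - y₁))) ∈
      regularNormalCone z Ω := by
  have hpos : 0 < ‖z.fst - x₂‖ := norm_pos_iff.2 (sub_ne_zero.2 hne)
  have d1 : HasFDerivAt (fun p : WithLp 2 (X × Y) => p.fst - x₂) (WithLp.fstL 2 ℝ X Y) z :=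
    (WithLp.fstL 2 ℝ X Y).hasFDerivAt.sub_const x₂
  have d2 : HasFDerivAt (fun p : WithLp 2 (X × Y) => p.snd - y₁) (WithLp.sndL 2 ℝ X Y) z :=
    (WithLp.sndL 2 ℝ X Y).hasFDerivAt.sub_const y₁
  have d3 := d1.norm_sq.sqrt (pow_ne_zero 2 hpos.ne')
  simp only [Real.sqrt_sq (norm_nonneg _)] at d3
  refine mem_regularNormalCone_of_isLocalMinOn (d3.add (d2.norm_sq.const_mul a)) hmin fun h => ?_
  simp [WithLp.prod_inner_apply, inner_neg_left, real_inner_smul_left, WithLp.fstL, WithLp.sndL,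
    inner_sub_left]
  field_simp
  ring

/-- Given `y₁ ∈ F x₁`, a point of `F x₂` is found by minimizing `‖x - x₂‖` plus a quadratic penalty
in `y - y₁` over a compact piece of the graph. A minimizer off the fibre of `x₂` would yield a
normal violating the uniform bound. -/
theorem lipschitzLike_of_coderivative_zero [FiniteDimensional ℝ X] [FiniteDimensional ℝ Y]
    {F : X → Set Y} {x₀ : X} {y₀ : Y}
    (hcl : ∃ r > (0 : ℝ), IsClosed (gph F ∩ Metric.closedBall (WithLp.toLp 2 (x₀, y₀)) r))
    (hD : ∀ u ∈ coderivative F x₀ y₀ 0, u = 0) : LipschitzLike F x₀ y₀ := by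
  obtain ⟨r₀, hr₀, hcl⟩ := hcl
  obtain ⟨κ, hκ, δ₀, hδ₀, hN⟩ := exists_norm_fst_le_of_coderivative hD
  -- At a minimizer `‖z.snd - y₁‖ ≤ r / s`, so the penalty gradient has norm at most `2 * s = 1 / (2
  -- * κ)`. A unit first component would then give `1 ≤ 1 / 2`.
  set s : ℝ := 1 / (4 * κ) with hs
  have hspos : 0 < s := by positivity
  set δ := min r₀ δ₀ with hδ
  have hδpos : 0 < δ := lt_min hr₀ hδ₀
  -- The minimizer lies within `(4 + 2 / s) * ρ` of the reference point; the `5` makes this strictly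
  -- less than `δ`.
  set ρ := δ / (5 + 2 / s) with hρ
  have hρpos : 0 < ρ := by positivity
  have hρδ : 3 * ρ + (2 * ρ / s + ρ) < δ := by
    have : ρ * (5 + 2 / s) = δ := by rw [hρ]; field_simp
    have h2 : 2 * ρ / s = ρ * (2 / s) := by ring
    rw [h2]; nlinarith
  refine ⟨Metric.ball x₀ ρ, Metric.ball_mem_nhds _ hρpos, Metric.ball y₀ ρ,
    Metric.ball_mem_nhds _ hρpos, 1 / s, by positivity, ?_⟩
  rintro x₁ hx₁ x₂ hx₂ y₁ ⟨hy₁F, hy₁⟩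
  rw [Metric.mem_ball, dist_eq_norm] at hx₁ hx₂ hy₁
  by_cases h12 : x₁ = x₂
  · exact ⟨y₁, h12 ▸ hy₁F, by simp [h12]⟩
  set r := ‖x₁ - x₂‖ with hr
  have hrpos : 0 < r := norm_pos_iff.2 (sub_ne_zero.2 h12)
  have hr2 : r < 2 * ρ := by
    have := norm_sub_le (x₁ - x₀) (x₂ - x₀)
    rw [sub_sub_sub_cancel_right] at this
    linarith
  set z₀ : WithLp 2 (X × Y) := WithLp.toLp 2 (x₀, y₀) with hz₀
  have hdist : ∀ p : WithLp 2 (X × Y), dist p z₀ ≤ ‖p.fst - x₀‖ + ‖p.snd - y₀‖ := fun p => by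
    rw [dist_eq_norm]
    exact norm_le_norm_fst_add_norm_snd (p - z₀)
  set g : WithLp 2 (X × Y) → ℝ := fun p => ‖p.fst - x₂‖ + s ^ 2 / r * ‖p.snd - y₁‖ ^ 2 with hg
  have hgc : Continuous g := by
    have h1 := WithLp.continuous_fst 2 X Y
    have h2 := WithLp.continuous_snd 2 X Y
    exact ((h1.sub continuous_const).norm).add
      ((((h2.sub continuous_const).norm).pow 2).const_mul _)
  have hcpt : IsCompact (gph F ∩ Metric.closedBall z₀ r₀) := by
    have := FiniteDimensional.proper ℝ (WithLp 2 (X × Y))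
    exact (isCompact_closedBall z₀ r₀).of_isClosed_subset hcl inter_subset_right
  have hmem : WithLp.toLp 2 (x₁, y₁) ∈ gph F ∩ Metric.closedBall z₀ r₀ := by
    refine ⟨hy₁F, ?_⟩
    have h1 := hdist (WithLp.toLp 2 (x₁, y₁))
    simp only [WithLp.toLp_fst, WithLp.toLp_snd] at h1
    have : 0 < 2 * ρ / s := by positivity
    rw [Metric.mem_closedBall]
    linarith [min_le_left r₀ δ₀]
  obtain ⟨z, ⟨hzF, -⟩, hzmin⟩ := hcpt.exists_isMinOn ⟨_, hmem⟩ hgc.continuousOn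
  have hzr : g z ≤ r := by
    have := hzmin hmem
    simpa [hg, hr] using this
  have hq : 0 < s ^ 2 / r := by positivity
  have hz1 : ‖z.fst - x₂‖ ≤ r := by
    have : 0 ≤ s ^ 2 / r * ‖z.snd - y₁‖ ^ 2 := by positivity
    simp only [hg] at hzr
    linarith
  have hz2 : ‖z.snd - y₁‖ ≤ r / s := by
    have h1 : s ^ 2 / r * ‖z.snd - y₁‖ ^ 2 ≤ r := by
      simp only [hg] at hzr
      linarith [norm_nonneg (z.fst - x₂)]
    have h2 : (s * ‖z.snd - y₁‖) ^ 2 ≤ r ^ 2 := by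
      rw [div_mul_eq_mul_div, div_le_iff₀ hrpos] at h1
      rw [mul_pow, sq r]; exact h1
    rw [le_div_iff₀ hspos, mul_comm]
    exact le_of_sq_le_sq h2 hrpos.le
  have hzd : dist z z₀ < δ := by
    have h1 := hdist z
    have h2 := norm_add_le (z.fst - x₂) (x₂ - x₀)
    have h3 := norm_add_le (z.snd - y₁) (y₁ - y₀)
    rw [sub_add_sub_cancel] at h2 h3
    have h4 : r / s ≤ 2 * ρ / s := by gcongr
    linarith
  have hfst : z.fst = x₂ := by
    by_contra hne
    have hpos : 0 < ‖z.fst - x₂‖ := norm_pos_iff.2 (sub_ne_zero.2 hne)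
    -- The minimizer is interior to the ball, so truncating the graph is harmless.
    have hloc : IsLocalMinOn g (gph F) z := by
      have hball : Metric.ball z₀ δ ∈ 𝓝 z := Metric.isOpen_ball.mem_nhds hzd
      filter_upwards [self_mem_nhdsWithin, nhdsWithin_le_nhds hball] with p hp hpb
      refine hzmin ⟨hp, ?_⟩
      rw [Metric.mem_ball] at hpb
      rw [Metric.mem_closedBall]
      exact hpb.le.trans (min_le_left _ _)
    have h1 := hN z hzF (hzd.trans_le (min_le_right _ _)) _ (regularNormal_of_isLocalMinOn hne hloc)
    simp only [WithLp.toLp_fst, WithLp.toLp_snd, norm_neg, norm_smul, norm_inv, norm_norm] at h1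
    rw [inv_mul_cancel₀ hpos.ne', Real.norm_of_nonneg (by positivity)] at h1
    have h2 : κ * (2 * (s ^ 2 / r) * ‖z.snd - y₁‖) ≤ κ * (2 * (s ^ 2 / r) * (r / s)) := by gcongr
    have h3 : κ * (2 * (s ^ 2 / r) * (r / s)) = 1 / 2 := by
      rw [hs]; field_simp; norm_num
    linarith
  refine ⟨z.snd, hfst ▸ hzF, ?_⟩
  rw [norm_sub_rev]
  calc _ ≤ r / s := hz2
    _ = 1 / s * r := by ring

end Criterion

end VariationalSystems

namespace VariationalSystems

/-! ### Normals to the graph of a parametrized system -/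

section GraphTransformation

variable {E F G : Type*} [NormedAddCommGroup E] [InnerProductSpace ℝ E] [FiniteDimensional ℝ E]
  [NormedAddCommGroup F] [InnerProductSpace ℝ F] [FiniteDimensional ℝ F]
  [NormedAddCommGroup G] [NormedSpace ℝ G]

omit [FiniteDimensional ℝ E] [FiniteDimensional ℝ F] in
theorem hasFDerivAt_toLp_prodMk {f : G → E} {g : G → F} {f' : G →L[ℝ] E} {g' : G →L[ℝ] F} {x : G}
    (hf : HasFDerivAt f f' x) (hg : HasFDerivAt g g' x) :
    HasFDerivAt (fun y => WithLp.toLp 2 (f y, g y))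
      ((WithLp.prodContinuousLinearEquiv 2 ℝ E F).symm.toContinuousLinearMap ∘L f'.prod g') x :=
  (WithLp.prodContinuousLinearEquiv 2 ℝ E F).symm.hasFDerivAt.comp x (hf.prodMk hg)

/-- The system `p₁ = K (x, v)`, `v ∈ M (p₂ + Φ x)` in the unknowns `(x, v)`. -/
def SolvesSystem (K : E × F → E) (Φ : E → F) (M : F → Set F)
    (S : WithLp 2 (E × F) → Set (WithLp 2 (E × F))) (x : E) : Prop :=
  ∀ p v, WithLp.toLp 2 (x, v) ∈ S p ↔ p.fst = K (x, v) ∧ v ∈ M (p.snd + Φ x)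

variable {K : E × F → E} {Φ : E → F} {M : F → Set F}
  {S : WithLp 2 (E × F) → Set (WithLp 2 (E × F))} {x : E} {z v : F}

open ContinuousLinearMap (adjoint inl inr adjoint_inner_left)

/-- Regular normals to the graph of `M` lift to regular normals to the graph of `S`. -/
theorem regularNormal_graph_lift (hS : ∀ᶠ x' in 𝓝 x, SolvesSystem K Φ M S x')
    {Q : E × F →L[ℝ] E} (hK : HasFDerivAt K Q (x, v)) {A : E →L[ℝ] F} (hΦ : HasFDerivAt Φ A x)
    {b e : F} (hn : WithLp.toLp 2 (b, e) ∈ regularNormalCone (WithLp.toLp 2 (z, v)) (gph M))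
    (a : E) :
    WithLp.toLp 2 (WithLp.toLp 2 (a, b),
      WithLp.toLp 2 (adjoint A b - adjoint (Q ∘L inl ℝ E F) a, e - adjoint (Q ∘L inr ℝ E F) a)) ∈
      regularNormalCone
        (WithLp.toLp 2 (WithLp.toLp 2 (K (x, v), z - Φ x), WithLp.toLp 2 (x, v))) (gph S) := by
  set q₀ : WithLp 2 (WithLp 2 (E × F) × WithLp 2 (E × F)) :=
    WithLp.toLp 2 (WithLp.toLp 2 (K (x, v), z - Φ x), WithLp.toLp 2 (x, v)) with hq₀
  let P := WithLp.fstL 2 ℝ (WithLp 2 (E × F)) (WithLp 2 (E × F))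
  let R := WithLp.sndL 2 ℝ (WithLp 2 (E × F)) (WithLp 2 (E × F))
  let π₁ := WithLp.fstL 2 ℝ E F
  let π₂ := WithLp.sndL 2 ℝ E F
  have hx : HasFDerivAt (fun q : WithLp 2 (WithLp 2 (E × F) × WithLp 2 (E × F)) => q.snd.fst)
    (π₁ ∘L R) q₀ := (π₁ ∘L R).hasFDerivAt
  have hv : HasFDerivAt (fun q : WithLp 2 (WithLp 2 (E × F) × WithLp 2 (E × F)) => q.snd.snd)
    (π₂ ∘L R) q₀ := (π₂ ∘L R).hasFDerivAt
  have hp₁ : HasFDerivAt (fun q : WithLp 2 (WithLp 2 (E × F) × WithLp 2 (E × F)) => q.fst.fst)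
    (π₁ ∘L P) q₀ := (π₁ ∘L P).hasFDerivAt
  have hp₂ : HasFDerivAt (fun q : WithLp 2 (WithLp 2 (E × F) × WithLp 2 (E × F)) => q.fst.snd)
    (π₂ ∘L P) q₀ := (π₂ ∘L P).hasFDerivAt
  have hΦ' := HasFDerivAt.comp q₀ (f := fun q : WithLp 2 (WithLp 2 (E × F) × WithLp 2 (E × F)) =>
    q.snd.fst) hΦ hx
  have hK' := HasFDerivAt.comp q₀ (f := fun q : WithLp 2 (WithLp 2 (E × F) × WithLp 2 (E × F)) =>
    (q.snd.fst, q.snd.snd)) hK (hx.prodMk hv)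
  have hSev : ∀ᶠ q in 𝓝[gph S] q₀, SolvesSystem K Φ M S q.snd.fst := by
    have : Tendsto (fun q : WithLp 2 (WithLp 2 (E × F) × WithLp 2 (E × F)) => q.snd.fst)
      (𝓝[gph S] q₀) (𝓝 x) := (hx.continuousAt.tendsto).mono_left nhdsWithin_le_nhds
    exact this.eventually hS
  -- The normal is a sum of two pullbacks: of `(b, e)` along `(p₂ + Φ x, v)`, which maps into `gph
  -- M`, and of `a` along `p₁ - K (x, v)`, which maps into `{0}`, where every vector is normal.
  have h1 : WithLp.toLp 2 (WithLp.toLp 2 ((0 : E), b), WithLp.toLp 2 (adjoint A b, e)) ∈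
      regularNormalCone q₀ (gph S) := by
    refine mem_regularNormalCone_of_hasFDerivAt (Ω' := gph M) (v := WithLp.toLp 2 (b, e))
      (hasFDerivAt_toLp_prodMk (hp₂.add hΦ') hv) ?_ ?_ ?_
    · filter_upwards [hSev, self_mem_nhdsWithin] with q hq hqS
      exact ((hq q.fst q.snd.snd).1 hqS).2
    · simpa [hq₀] using hn
    · intro h
      simp [WithLp.prod_inner_apply, adjoint_inner_left, inner_add_right, P, R, π₁, π₂,
        WithLp.fstL, WithLp.sndL, WithLp.prodContinuousLinearEquiv_symm_apply]
      ring
  have h2 : WithLp.toLp 2 (WithLp.toLp 2 (a, (0 : F)),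
      WithLp.toLp 2 (-adjoint (Q ∘L inl ℝ E F) a, -adjoint (Q ∘L inr ℝ E F) a)) ∈
      regularNormalCone q₀ (gph S) := by
    refine mem_regularNormalCone_of_hasFDerivAt (Ω' := {(0 : E)}) (v := a)
      (hp₁.sub hK') ?_ ?_ ?_
    · filter_upwards [hSev, self_mem_nhdsWithin] with q hq hqS
      exact sub_eq_zero.2 ((hq q.fst q.snd.snd).1 hqS).1
    · have h0 : q₀.fst.fst - K (q₀.snd.fst, q₀.snd.snd) = 0 := by simp [hq₀]
      have := mem_regularNormalCone_singleton (0 : E) a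
      rw [← h0] at this
      simpa [h0] using this
    · intro h
      have hQ : Q (h.snd.fst, h.snd.snd) = Q (h.snd.fst, 0) + Q (0, h.snd.snd) := by
        rw [← map_add]; simp
      simp [WithLp.prod_inner_apply, adjoint_inner_left, inner_sub_right, inner_neg_left, P, R,
        π₁, π₂, WithLp.fstL, WithLp.sndL, hQ, inner_add_right]
      ring
  convert add_mem_regularNormalCone h1 h2 using 1
  simp [← WithLp.toLp_add, sub_eq_add_neg]

/-- Regular normals to the graph of `S` come from regular normals to the graph of `M`. -/
theorem regularNormal_graph_descend (hS : ∀ᶠ x' in 𝓝 x, SolvesSystem K Φ M S x')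
    {Q : E × F →L[ℝ] E} (hK : HasFDerivAt K Q (x, v)) {A : E →L[ℝ] F} (hΦ : HasFDerivAt Φ A x)
    (hz : v ∈ M z) {w : WithLp 2 (WithLp 2 (E × F) × WithLp 2 (E × F))}
    (hw : w ∈ regularNormalCone
        (WithLp.toLp 2 (WithLp.toLp 2 (K (x, v), z - Φ x), WithLp.toLp 2 (x, v))) (gph S)) :
    WithLp.toLp 2 (w.fst.snd, w.snd.snd + adjoint (Q ∘L inr ℝ E F) w.fst.fst) ∈
        regularNormalCone (WithLp.toLp 2 (z, v)) (gph M) ∧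
      w.snd.fst + adjoint (Q ∘L inl ℝ E F) w.fst.fst - adjoint A w.fst.snd = 0 := by
  constructor
  -- With `x` frozen, `(z', v') ↦ ((K (x, v'), z' - Φ x), (x, v'))` embeds `gph M` into `gph S`.
  · let π₁ := WithLp.fstL 2 ℝ F F
    let π₂ := WithLp.sndL 2 ℝ F F
    have hz' : HasFDerivAt (fun q : WithLp 2 (F × F) => q.fst - Φ x) π₁ (WithLp.toLp 2 (z, v)) :=
      π₁.hasFDerivAt.sub_const _
    have hv' : HasFDerivAt (fun q : WithLp 2 (F × F) => q.snd) π₂ (WithLp.toLp 2 (z, v)) :=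
      π₂.hasFDerivAt
    have hx' := hasFDerivAt_const (𝕜 := ℝ) x (WithLp.toLp 2 (z, v))
    have hK' := HasFDerivAt.comp (WithLp.toLp 2 (z, v)) (f := fun q : WithLp 2 (F × F) =>
      (x, q.snd)) hK (hx'.prodMk hv')
    refine mem_regularNormalCone_of_hasFDerivAt (Ω' := gph S) (v := w)
      (hasFDerivAt_toLp_prodMk (hasFDerivAt_toLp_prodMk hK' hz') (hasFDerivAt_toLp_prodMk hx' hv'))
      ?_ ?_ ?_
    · filter_upwards [self_mem_nhdsWithin] with q hq
      exact (hS.self_of_nhds _ _).2 ⟨rfl, by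
        change q.snd ∈ M (q.fst - Φ x + Φ x)
        rw [sub_add_cancel]
        exact hq⟩
    · simpa using hw
    · intro h
      simp [WithLp.prod_inner_apply, adjoint_inner_left, inner_add_left, π₁, π₂,
        WithLp.fstL, WithLp.sndL, WithLp.prodContinuousLinearEquiv_symm_apply]
      ring
  -- With `(z, v)` frozen, `x` moves freely inside `gph S`, so the pulled-back normal vanishes; this
  -- is the equation.
  · refine eq_zero_of_mem_regularNormalCone (z := x) (Ω := univ) univ_mem ?_
    have hx' := hasFDerivAt_id (𝕜 := ℝ) x
    have hv' := hasFDerivAt_const (𝕜 := ℝ) v x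
    have hK' := HasFDerivAt.comp x (f := fun y : E => (y, v)) hK (hx'.prodMk hv')
    refine mem_regularNormalCone_of_hasFDerivAt (Ω' := gph S) (v := w)
      (hasFDerivAt_toLp_prodMk (hasFDerivAt_toLp_prodMk hK' (hΦ.const_sub z))
        (hasFDerivAt_toLp_prodMk hx' hv')) ?_ ?_ ?_
    · rw [nhdsWithin_univ]
      filter_upwards [hS] with y hy
      exact (hy _ _).2 ⟨rfl, by simpa using hz⟩
    · simpa using hw
    · intro h
      simp [WithLp.prod_inner_apply, adjoint_inner_left, inner_add_left, inner_sub_left,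
        WithLp.prodContinuousLinearEquiv_symm_apply]
      ring

/-- The correspondence of regular normals passes to limits because the derivatives of `K` and `Φ`
are continuous. Descending uses nearby graph points with varying `x`; for lifting, sequences with
`x` and `a` fixed suffice. -/
theorem mem_coderivative_iff_of_solvesSystem (hS : ∀ᶠ x' in 𝓝 x, SolvesSystem K Φ M S x')
    (hK : ContDiffAt ℝ 1 K (x, v)) (hΦ : ContDiffAt ℝ 1 Φ x) (a : E) (b : F) :
    WithLp.toLp 2 (a, b) ∈
        coderivative S (WithLp.toLp 2 (K (x, v), z - Φ x)) (WithLp.toLp 2 (x, v)) 0 ↔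
      adjoint (fderiv ℝ K (x, v) ∘L inl ℝ E F) a = adjoint (fderiv ℝ Φ x) b ∧
      WithLp.toLp 2 (b, adjoint (fderiv ℝ K (x, v) ∘L inr ℝ E F) a) ∈
        limitingNormalCone (WithLp.toLp 2 (z, v)) (gph M) := by
  have hKc : ContinuousAt (fderiv ℝ K) (x, v) := (hK.fderiv_right (m := 0) (by norm_num)).continuousAt
  have hΦc : ContinuousAt (fderiv ℝ Φ) x := (hΦ.fderiv_right (m := 0) (by norm_num)).continuousAt
  have hKev : ∀ᶠ p in 𝓝 (x, v), DifferentiableAt ℝ K p :=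
    (hK.eventually (by simp)).mono fun p hp => hp.differentiableAt (by norm_num)
  have hΦev : ∀ᶠ y in 𝓝 x, DifferentiableAt ℝ Φ y :=
    (hΦ.eventually (by simp)).mono fun p hp => hp.differentiableAt (by norm_num)
  have hadjc : Continuous fun T : (E × F →L[ℝ] E) × E => adjoint (T.1 ∘L inl ℝ E F) T.2 :=
    ((adjoint (𝕜 := ℝ) (E := E) (F := E)).continuous.comp
      (continuous_fst.clm_comp continuous_const)).clm_apply continuous_snd
  have hadjc' : Continuous fun T : (E × F →L[ℝ] E) × E => adjoint (T.1 ∘L inr ℝ E F) T.2 :=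
    ((adjoint (𝕜 := ℝ) (E := F) (F := E)).continuous.comp
      (continuous_fst.clm_comp continuous_const)).clm_apply continuous_snd
  have hadjΦ : Continuous fun T : (E →L[ℝ] F) × F => adjoint T.1 T.2 :=
    ((adjoint (𝕜 := ℝ) (E := E) (F := F)).continuous.comp continuous_fst).clm_apply continuous_snd
  constructor
  · rintro ⟨q, w, hq, hqt, hw, hwt⟩
    have hxt := tendsto_withLp_fst (tendsto_withLp_snd hqt)
    have hvt := tendsto_withLp_snd (tendsto_withLp_snd hqt)
    have hpt := tendsto_withLp_snd (tendsto_withLp_fst hqt)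
    have hwa := tendsto_withLp_fst (tendsto_withLp_fst hwt)
    have hwb := tendsto_withLp_snd (tendsto_withLp_fst hwt)
    have hwc := tendsto_withLp_fst (tendsto_withLp_snd hwt)
    have hwd := tendsto_withLp_snd (tendsto_withLp_snd hwt)
    simp only [WithLp.toLp_fst, WithLp.toLp_snd, neg_zero, WithLp.zero_fst, WithLp.zero_snd]
      at hxt hvt hpt hwa hwb hwc hwd
    have hxv := hxt.prodMk_nhds hvt
    have hQt := hKc.tendsto.comp hxv
    have hAt := hΦc.tendsto.comp hxt
    have hev : ∀ᶠ k in atTop,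
        (WithLp.toLp 2 ((q k).fst.snd + Φ (q k).snd.fst, (q k).snd.snd) ∈ gph M ∧
        WithLp.toLp 2 ((w k).fst.snd, (w k).snd.snd + adjoint
          (fderiv ℝ K ((q k).snd.fst, (q k).snd.snd) ∘L inr ℝ E F) (w k).fst.fst) ∈
          regularNormalCone (WithLp.toLp 2 ((q k).fst.snd + Φ (q k).snd.fst, (q k).snd.snd))
            (gph M)) ∧
        (w k).snd.fst + adjoint (fderiv ℝ K ((q k).snd.fst, (q k).snd.snd) ∘L inl ℝ E F)
          (w k).fst.fst - adjoint (fderiv ℝ Φ (q k).snd.fst) (w k).fst.snd = 0 := by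
      filter_upwards [hxt.eventually (eventually_eventually_nhds.2 hS), hxv.eventually hKev,
        hxt.eventually hΦev] with k h1 h2 h3
      have h4 := (h1.self_of_nhds (q k).fst (q k).snd.snd).1 (hq k)
      have h5 := regularNormal_graph_descend h1 h2.hasFDerivAt h3.hasFDerivAt h4.2 (w := w k) (by
        have h6 := hw k
        rw [add_sub_cancel_right, ← h4.1]
        exact h6)
      exact ⟨⟨h4.2, h5.1⟩, h5.2⟩
    constructor
    · have hlim := (hwc.add ((hadjc.tendsto _).comp (hQt.prodMk_nhds hwa))).sub
        ((hadjΦ.tendsto _).comp (hAt.prodMk_nhds hwb))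
      have h0 := tendsto_nhds_unique (hlim.congr' (hev.mono fun k hk => hk.2)) tendsto_const_nhds
      rw [zero_add] at h0
      exact sub_eq_zero.1 h0
    · refine limitingNormalCone_of_tendsto (hev.mono fun k hk => hk.1) ?_ ?_
      · have := hpt.add (hΦ.continuousAt.tendsto.comp hxt)
        rw [sub_add_cancel] at this
        exact tendsto_toLp_prodMk this hvt
      · have := hwd.add ((hadjc'.tendsto _).comp (hQt.prodMk_nhds hwa))
        rw [zero_add] at this
        exact tendsto_toLp_prodMk hwb this
  · rintro ⟨heq, q, w, hq, hqt, hw, hwt⟩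
    have hzt := tendsto_withLp_fst hqt
    have hvt := tendsto_withLp_snd hqt
    have hwb := tendsto_withLp_fst hwt
    have hwe := tendsto_withLp_snd hwt
    simp only [WithLp.toLp_fst, WithLp.toLp_snd] at hzt hvt hwb hwe
    have hxv : Tendsto (fun k => (x, (q k).snd)) atTop (𝓝 (x, v)) :=
      tendsto_const_nhds.prodMk_nhds hvt
    have hQt := hKc.tendsto.comp hxv
    have hat : Tendsto (fun _ : ℕ => a) atTop (𝓝 a) := tendsto_const_nhds
    have hAt : Tendsto (fun _ : ℕ => fderiv ℝ Φ x) atTop (𝓝 (fderiv ℝ Φ x)) := tendsto_const_nhds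
    refine limitingNormalCone_of_tendsto
      (zs := fun k => WithLp.toLp 2 (WithLp.toLp 2 (K (x, (q k).snd), (q k).fst - Φ x),
        WithLp.toLp 2 (x, (q k).snd)))
      (vs := fun k => WithLp.toLp 2 (WithLp.toLp 2 (a, (w k).fst), WithLp.toLp 2
        (adjoint (fderiv ℝ Φ x) (w k).fst - adjoint (fderiv ℝ K (x, (q k).snd) ∘L inl ℝ E F) a,
          (w k).snd - adjoint (fderiv ℝ K (x, (q k).snd) ∘L inr ℝ E F) a))) ?_ ?_ ?_
    · filter_upwards [hxv.eventually hKev] with k hk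
      refine ⟨(hS.self_of_nhds _ _).2 ⟨rfl, by
        change (q k).snd ∈ M ((q k).fst - Φ x + Φ x)
        rw [sub_add_cancel]
        exact hq k⟩, ?_⟩
      exact regularNormal_graph_lift hS hk.hasFDerivAt hΦev.self_of_nhds.hasFDerivAt (hw k) a
    · exact tendsto_toLp_prodMk (tendsto_toLp_prodMk (hK.continuousAt.tendsto.comp hxv) (hzt.sub_const _))
        (tendsto_toLp_prodMk tendsto_const_nhds hvt)
    · have h1 := ((hadjΦ.tendsto _).comp (hAt.prodMk_nhds hwb)).sub
        ((hadjc.tendsto _).comp (hQt.prodMk_nhds hat))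
      have h2 := hwe.sub ((hadjc'.tendsto _).comp (hQt.prodMk_nhds hat))
      simp only [heq, sub_self] at h1 h2
      rw [neg_zero]
      exact tendsto_toLp_prodMk (tendsto_toLp_prodMk hat hwb) (tendsto_toLp_prodMk h1 h2)

end GraphTransformation

end VariationalSystems

namespace VariationalSystems

/-! ### Closedness of the subdifferential graph -/

section Subdifferential

variable {E : Type*} [NormedAddCommGroup E] [InnerProductSpace ℝ E]

theorem IsPolyhedron.isClosed {C : Set E} (hC : IsPolyhedron C) : IsClosed C := by
  obtain ⟨k, a, b, rfl⟩ := hC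
  simp only [ofPred_forall]
  exact isClosed_iInter fun i => isClosed_le (by fun_prop) continuous_const

/-- For each fixed `p` the right side places a continuous function of `(z, v)` in the epigraph, so a
closed epigraph gives a closed graph. The point `u₀` rules out an empty epigraph, for which the
condition would be vacuous. -/
theorem mem_subdiff_iff_epi {θ : E → EReal} (hθ : ∀ z, θ z ≠ ⊥) {u₀ : E} (hu₀ : θ u₀ < ⊤)
    (z v : E) : v ∈ subdiff θ z ↔ ∀ p ∈ epi θ,
      WithLp.toLp 2 (z, p.snd - inner ℝ v (p.fst - z)) ∈ epi θ := by
  constructor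
  · rintro ⟨hz, hv⟩ p hp
    have h1 := (hv p.fst).trans hp
    change θ z ≤ ((p.snd - inner ℝ v (p.fst - z) : ℝ) : EReal)
    lift θ z to ℝ using ⟨hz.ne, hθ z⟩ with t
    norm_cast at h1 ⊢
    linarith
  · intro h
    have key : ∀ u, ∀ t : ℝ, θ u = t → θ z + ((inner ℝ v (u - z) : ℝ) : EReal) ≤ θ u ∧ θ z < ⊤ := by
      intro u t hu
      have h1 : θ z ≤ ((t - inner ℝ v (u - z) : ℝ) : EReal) :=
        h (WithLp.toLp 2 (u, t)) (show θ u ≤ (t : EReal) from hu.le)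
      have h2 : θ z < ⊤ := h1.trans_lt (EReal.coe_lt_top _)
      rw [hu]
      refine ⟨?_, h2⟩
      lift θ z to ℝ using ⟨h2.ne, hθ z⟩ with s
      norm_cast at h1 ⊢
      linarith
    refine ⟨(key u₀ (θ u₀).toReal (EReal.coe_toReal hu₀.ne (hθ u₀)).symm).2, fun u => ?_⟩
    by_cases hu : θ u = ⊤
    · rw [hu]; exact le_top
    · exact (key u (θ u).toReal (EReal.coe_toReal hu (hθ u)).symm).1

theorem isClosed_gph_subdiff {θ : E → EReal} (hθ : IsCPWL θ) {u₀ : E} (hu₀ : θ u₀ < ⊤) :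
    IsClosed (gph (subdiff θ)) := by
  have heq : gph (subdiff θ) = ⋂ p ∈ epi θ, (fun q : WithLp 2 (E × E) =>
      WithLp.toLp 2 (q.fst, p.snd - inner ℝ q.snd (p.fst - q.fst))) ⁻¹' epi θ := by
    ext q
    simp only [mem_iInter, mem_preimage]
    exact mem_subdiff_iff_epi hθ.1 hu₀ q.fst q.snd
  rw [heq]
  refine isClosed_biInter fun p _ => hθ.2.isClosed.preimage ?_
  have h1 := WithLp.continuous_fst 2 E E
  have h2 := WithLp.continuous_snd 2 E E
  exact (WithLp.prod_continuous_toLp 2 E ℝ).comp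
    (h1.prodMk (continuous_const.sub (h2.inner (continuous_const.sub h1))))

end Subdifferential

/-! ### The KKT system: derivatives of the partial gradient and local closedness -/

section LagrangianGradient

variable {n m : ℕ} {φ₀ : EuclideanSpace ℝ (Fin n) → ℝ}
  {Φ : EuclideanSpace ℝ (Fin n) → EuclideanSpace ℝ (Fin m)} {x : EuclideanSpace ℝ (Fin n)}

open ContinuousLinearMap (adjoint inl inr adjoint_inner_left)

/-- The inverse Riesz isomorphism of a finite-dimensional real inner product space, as a
(truly linear) continuous map. -/
noncomputable def rieszInv (E : Type*) [NormedAddCommGroup E] [InnerProductSpace ℝ E]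
    [FiniteDimensional ℝ E] : (E →L[ℝ] ℝ) →L[ℝ] E :=
  LinearMap.toContinuousLinearMap
    { toFun := fun T =>
        haveI := FiniteDimensional.complete ℝ E
        (InnerProductSpace.toDual ℝ E).symm T
      map_add' := fun S T => map_add _ S T
      map_smul' := fun c T => by simp }

theorem rieszInv_apply {E : Type*} [NormedAddCommGroup E] [InnerProductSpace ℝ E]
    [FiniteDimensional ℝ E] [CompleteSpace E] (T : E →L[ℝ] ℝ) :
    rieszInv E T = (InnerProductSpace.toDual ℝ E).symm T := rfl

theorem inner_rieszInv {E : Type*} [NormedAddCommGroup E] [InnerProductSpace ℝ E]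
    [FiniteDimensional ℝ E] (T : E →L[ℝ] ℝ) (h : E) : inner ℝ (rieszInv E T) h = T h := by
  have := FiniteDimensional.complete ℝ E
  rw [rieszInv_apply]
  exact InnerProductSpace.toDual_symm_apply

/-- The partial gradient `∇ₓL`, as a function of `(x, v)`. -/
noncomputable def lagrangianGradient (φ₀ : EuclideanSpace ℝ (Fin n) → ℝ)
    (Φ : EuclideanSpace ℝ (Fin n) → EuclideanSpace ℝ (Fin m))
    (p : EuclideanSpace ℝ (Fin n) × EuclideanSpace ℝ (Fin m)) : EuclideanSpace ℝ (Fin n) :=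
  rieszInv _ (fderiv ℝ φ₀ p.1 + innerSL ℝ p.2 ∘L fderiv ℝ Φ p.1)

theorem lagrangianGradient_eq (x : EuclideanSpace ℝ (Fin n)) (v : EuclideanSpace ℝ (Fin m)) :
    lagrangianGradient φ₀ Φ (x, v) =
      rieszInv _ (fderiv ℝ φ₀ x) + adjoint (fderiv ℝ Φ x) v := by
  refine ext_inner_right ℝ fun h => ?_
  rw [lagrangianGradient, inner_rieszInv, inner_add_left, inner_rieszInv, adjoint_inner_left]
  simp

theorem contDiffAt_lagrangianGradient (hφ₀ : ContDiffAt ℝ 2 φ₀ x) (hΦ : ContDiffAt ℝ 2 Φ x)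
    (v : EuclideanSpace ℝ (Fin m)) : ContDiffAt ℝ 1 (lagrangianGradient φ₀ Φ) (x, v) := by
  have h1 : ContDiffAt ℝ 1 (fderiv ℝ φ₀) x := hφ₀.fderiv_right (by norm_num)
  have h2 : ContDiffAt ℝ 1 (fderiv ℝ Φ) x := hΦ.fderiv_right (by norm_num)
  have h3 : ContDiffAt ℝ 1 (fun p : EuclideanSpace ℝ (Fin n) × EuclideanSpace ℝ (Fin m) =>
    fderiv ℝ φ₀ p.1) (x, v) := ContDiffAt.comp (x, v) h1 contDiffAt_fst
  have h4 : ContDiffAt ℝ 1 (fun p : EuclideanSpace ℝ (Fin n) × EuclideanSpace ℝ (Fin m) =>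
    fderiv ℝ Φ p.1) (x, v) := ContDiffAt.comp (x, v) h2 contDiffAt_fst
  have h5 : ContDiffAt ℝ 1 (fun p : EuclideanSpace ℝ (Fin n) × EuclideanSpace ℝ (Fin m) =>
    innerSL ℝ p.2) (x, v) :=
    ((innerSL ℝ).contDiff (n := 1)).contDiffAt.comp (x, v) contDiffAt_snd
  exact (rieszInv _).contDiff.contDiffAt.comp (x, v) (h3.add (h5.clm_comp h4))

theorem hasGradientAt_lagrangian (hφ₀ : DifferentiableAt ℝ φ₀ x) (hΦ : DifferentiableAt ℝ Φ x)
    (v : EuclideanSpace ℝ (Fin m)) :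
    HasGradientAt (fun y => lagrangian φ₀ Φ y v) (lagrangianGradient φ₀ Φ (x, v)) x := by
  rw [hasGradientAt_iff_hasFDerivAt, lagrangianGradient, rieszInv_apply,
    LinearIsometryEquiv.apply_symm_apply]
  have h := hφ₀.hasFDerivAt.add ((innerSL ℝ v).hasFDerivAt.comp x hΦ.hasFDerivAt)
  refine h.congr_of_eventuallyEq (Eventually.of_forall fun y => ?_)
  simp [lagrangian, real_inner_comm]

theorem hessianXX_eq (hφ₀ : ContDiffAt ℝ 2 φ₀ x) (hΦ : ContDiffAt ℝ 2 Φ x)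
    (v : EuclideanSpace ℝ (Fin m)) :
    hessianXX φ₀ Φ x v = fderiv ℝ (lagrangianGradient φ₀ Φ) (x, v) ∘L inl ℝ _ _ := by
  have hev : (fun y => gradient (fun y' => lagrangian φ₀ Φ y' v) y) =ᶠ[𝓝 x]
      fun y => lagrangianGradient φ₀ Φ (y, v) := by
    filter_upwards [hφ₀.eventually (by simp), hΦ.eventually (by simp)] with y h1 h2
    exact (hasGradientAt_lagrangian (h1.differentiableAt (by norm_num))
      (h2.differentiableAt (by norm_num)) v).gradient
  rw [hessianXX, hev.fderiv_eq]
  have hd := ((contDiffAt_lagrangianGradient hφ₀ hΦ v).differentiableAt (by norm_num)).hasFDerivAt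
  exact (HasFDerivAt.comp x (f := fun y => (y, v)) hd
    ((hasFDerivAt_id x).prodMk (hasFDerivAt_const v x))).fderiv

theorem adjoint_hessianXX (hφ₀ : ContDiffAt ℝ 2 φ₀ x) (hΦ : ContDiffAt ℝ 2 Φ x)
    (v : EuclideanSpace ℝ (Fin m)) : adjoint (hessianXX φ₀ Φ x v) = hessianXX φ₀ Φ x v := by
  have hL : ContDiffAt ℝ 2 (fun y => lagrangian φ₀ Φ y v) x :=
    hφ₀.add (hΦ.inner ℝ contDiffAt_const)
  have hsymm := hL.isSymmSndFDerivAt (by simp)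
  have hd : DifferentiableAt ℝ (fderiv ℝ fun y => lagrangian φ₀ Φ y v) x :=
    (hL.fderiv_right (m := 1) (by norm_num)).differentiableAt (by norm_num)
  have hH : hessianXX φ₀ Φ x v =
      rieszInv _ ∘L fderiv ℝ (fderiv ℝ fun y => lagrangian φ₀ Φ y v) x :=
    ((rieszInv _).hasFDerivAt.comp x hd.hasFDerivAt).fderiv
  symm
  rw [ContinuousLinearMap.eq_adjoint_iff]
  intro h k
  rw [hH, ContinuousLinearMap.comp_apply, ContinuousLinearMap.comp_apply, inner_rieszInv,
    real_inner_comm, inner_rieszInv]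
  exact hsymm.eq h k

/-- The partial gradient is affine in `v` with linear part `∇Φ(x)^*`. -/
theorem adjoint_fderiv_lagrangianGradient_inr (hφ₀ : ContDiffAt ℝ 2 φ₀ x)
    (hΦ : ContDiffAt ℝ 2 Φ x) (v : EuclideanSpace ℝ (Fin m)) :
    adjoint (fderiv ℝ (lagrangianGradient φ₀ Φ) (x, v) ∘L inr ℝ _ _) = fderiv ℝ Φ x := by
  have hd := ((contDiffAt_lagrangianGradient hφ₀ hΦ v).differentiableAt (by norm_num)).hasFDerivAt
  have h1 := HasFDerivAt.comp v (f := fun y => (x, y)) hd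
    ((hasFDerivAt_const x v).prodMk (hasFDerivAt_id v))
  have h2 : HasFDerivAt (fun y => lagrangianGradient φ₀ Φ (x, y)) (adjoint (fderiv ℝ Φ x)) v := by
    simp only [lagrangianGradient_eq]
    exact (adjoint (fderiv ℝ Φ x)).hasFDerivAt.const_add _
  have h3 : fderiv ℝ (lagrangianGradient φ₀ Φ) (x, v) ∘L inr ℝ _ _ = adjoint (fderiv ℝ Φ x) :=
    h1.unique h2
  rw [h3, ContinuousLinearMap.adjoint_adjoint]

theorem solvesSystem_kktSolutionMap (θ : EuclideanSpace ℝ (Fin m) → EReal)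
    (hφ₀ : DifferentiableAt ℝ φ₀ x) (hΦ : DifferentiableAt ℝ Φ x) :
    SolvesSystem (lagrangianGradient φ₀ Φ) Φ (subdiff θ) (kktSolutionMap φ₀ Φ θ) x := by
  intro p v
  refine and_congr_left fun _ => ⟨fun h => ?_, fun h => ?_⟩
  · exact HasGradientAt.unique h (hasGradientAt_lagrangian hφ₀ hΦ v)
  · change HasGradientAt (fun y => lagrangian φ₀ Φ y v) p.fst x
    rw [h]
    exact hasGradientAt_lagrangian hφ₀ hΦ v

/-- Smoothness is only local, so closedness is claimed in a ball on which `φ₀` and `Φ` are `C²`.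
There the graph is the preimage of `{0} × gph ∂θ` under a continuous map. -/
theorem exists_isClosed_gph_kktSolutionMap_inter {θ : EuclideanSpace ℝ (Fin m) → EReal}
    (hφ₀ : ContDiffAt ℝ 2 φ₀ x) (hΦ : ContDiffAt ℝ 2 Φ x) (hθ : IsClosed (gph (subdiff θ)))
    (p : WithLp 2 (EuclideanSpace ℝ (Fin n) × EuclideanSpace ℝ (Fin m)))
    (v : EuclideanSpace ℝ (Fin m)) :
    ∃ r > (0 : ℝ), IsClosed (gph (kktSolutionMap φ₀ Φ θ) ∩
      Metric.closedBall (WithLp.toLp 2 (p, WithLp.toLp 2 (x, v))) r) := by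
  obtain ⟨r, hr, hball⟩ := Metric.nhds_basis_closedBall.eventually_iff.1
    ((hφ₀.eventually (by simp)).and (hΦ.eventually (by simp)))
  refine ⟨r, hr, ?_⟩
  set q₀ := WithLp.toLp 2 (p, WithLp.toLp 2 (x, v)) with hq₀
  have hmem : ∀ q ∈ Metric.closedBall q₀ r,
      ContDiffAt ℝ 2 φ₀ q.snd.fst ∧ ContDiffAt ℝ 2 Φ q.snd.fst := fun q hq =>
    hball (((WithLp.dist_fst_le _ _).trans (WithLp.dist_snd_le q q₀)).trans hq)
  let f : WithLp 2 (WithLp 2 (EuclideanSpace ℝ (Fin n) × EuclideanSpace ℝ (Fin m)) ×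
      WithLp 2 (EuclideanSpace ℝ (Fin n) × EuclideanSpace ℝ (Fin m))) →
      EuclideanSpace ℝ (Fin n) × WithLp 2 (EuclideanSpace ℝ (Fin m) × EuclideanSpace ℝ (Fin m)) :=
    fun q => (q.fst.fst - lagrangianGradient φ₀ Φ (q.snd.fst, q.snd.snd),
      WithLp.toLp 2 (q.fst.snd + Φ q.snd.fst, q.snd.snd))
  have hfc : ContinuousOn f (Metric.closedBall q₀ r) := by
    intro q hq
    obtain ⟨h1, h2⟩ := hmem q hq
    have c1 := WithLp.continuous_fst 2 (EuclideanSpace ℝ (Fin n)) (EuclideanSpace ℝ (Fin m))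
    have c2 := WithLp.continuous_snd 2 (EuclideanSpace ℝ (Fin n)) (EuclideanSpace ℝ (Fin m))
    have d1 := WithLp.continuous_fst 2
      (WithLp 2 (EuclideanSpace ℝ (Fin n) × EuclideanSpace ℝ (Fin m)))
      (WithLp 2 (EuclideanSpace ℝ (Fin n) × EuclideanSpace ℝ (Fin m)))
    have d2 := WithLp.continuous_snd 2
      (WithLp 2 (EuclideanSpace ℝ (Fin n) × EuclideanSpace ℝ (Fin m)))
      (WithLp 2 (EuclideanSpace ℝ (Fin n) × EuclideanSpace ℝ (Fin m)))
    have hK := ContinuousAt.comp (x := q) (f := fun q : WithLp 2 (WithLp 2 (EuclideanSpace ℝ (Fin n) ×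
      EuclideanSpace ℝ (Fin m)) × WithLp 2 (EuclideanSpace ℝ (Fin n) × EuclideanSpace ℝ (Fin m))) =>
      (q.snd.fst, q.snd.snd)) (contDiffAt_lagrangianGradient h1 h2 q.snd.snd).continuousAt
      ((c1.comp d2).prodMk (c2.comp d2)).continuousAt
    have hΦ' := ContinuousAt.comp (x := q) (f := fun q : WithLp 2 (WithLp 2 (EuclideanSpace ℝ (Fin n) ×
      EuclideanSpace ℝ (Fin m)) × WithLp 2 (EuclideanSpace ℝ (Fin n) × EuclideanSpace ℝ (Fin m))) =>
      q.snd.fst) h2.continuousAt (c1.comp d2).continuousAt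
    exact (((c1.comp d1).continuousAt.sub hK).prodMk
      ((WithLp.prod_continuous_toLp 2 _ _).continuousAt.comp
        (((c2.comp d1).continuousAt.add hΦ').prodMk (c2.comp d2).continuousAt))).continuousWithinAt
  have heq : gph (kktSolutionMap φ₀ Φ θ) ∩ Metric.closedBall q₀ r =
      Metric.closedBall q₀ r ∩ f ⁻¹' ({0} ×ˢ gph (subdiff θ)) := by
    ext q
    rw [inter_comm]
    refine and_congr_right fun hq => ?_
    obtain ⟨h1, h2⟩ := hmem q hq
    have hs := solvesSystem_kktSolutionMap θ (h1.differentiableAt (by norm_num))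
      (h2.differentiableAt (by norm_num)) q.fst q.snd.snd
    refine Iff.trans hs (and_congr_left fun _ => ?_)
    exact sub_eq_zero.symm
  rw [heq]
  exact hfc.preimage_isClosed_of_isClosed Metric.isClosed_closedBall (isClosed_singleton.prod hθ)

end LagrangianGradient

end VariationalSystems

/-! ### The characterization of Lipschitz-likeness -/

open VariationalSystems
theorem proposition8p1 {n m : ℕ} (φ₀ : EuclideanSpace ℝ (Fin n) → ℝ)
    (Φ : EuclideanSpace ℝ (Fin n) → EuclideanSpace ℝ (Fin m))
    (θ : EuclideanSpace ℝ (Fin m) → EReal)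
    (xbar : EuclideanSpace ℝ (Fin n)) (vbar : EuclideanSpace ℝ (Fin m))
    (hφ₀ : ContDiffAt ℝ 2 φ₀ xbar) (hΦ : ContDiffAt ℝ 2 Φ xbar) (hθ : IsCPWL θ)
    (hsol : WithLp.toLp 2 (xbar, vbar) ∈ kktSolutionMap φ₀ Φ θ (WithLp.toLp 2 (0, 0))) :
    LipschitzLike (kktSolutionMap φ₀ Φ θ) (WithLp.toLp 2 (0, 0)) (WithLp.toLp 2 (xbar, vbar)) ↔
      ∀ (ξ : EuclideanSpace ℝ (Fin n)) (η : EuclideanSpace ℝ (Fin m)),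
        hessianXX φ₀ Φ xbar vbar ξ + ContinuousLinearMap.adjoint (fderiv ℝ Φ xbar) η = 0 →
        η ∈ coderivative (subdiff θ) (Φ xbar) vbar (fderiv ℝ Φ xbar ξ) →
        ξ = 0 ∧ η = 0 := by
  have hS : ∀ᶠ x in 𝓝 xbar,
      SolvesSystem (lagrangianGradient φ₀ Φ) Φ (subdiff θ) (kktSolutionMap φ₀ Φ θ) x := by
    filter_upwards [hφ₀.eventually (by simp), hΦ.eventually (by simp)] with x h1 h2
    exact solvesSystem_kktSolutionMap θ (h1.differentiableAt (by norm_num))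
      (h2.differentiableAt (by norm_num))
  have hK0 : (0 : EuclideanSpace ℝ (Fin n)) = lagrangianGradient φ₀ Φ (xbar, vbar) :=
    ((hS.self_of_nhds _ _).1 hsol).1
  have hD : ∀ a b, WithLp.toLp 2 (a, b) ∈ coderivative (kktSolutionMap φ₀ Φ θ)
      (WithLp.toLp 2 (0, 0)) (WithLp.toLp 2 (xbar, vbar)) 0 ↔
      hessianXX φ₀ Φ xbar vbar a = ContinuousLinearMap.adjoint (fderiv ℝ Φ xbar) b ∧
      WithLp.toLp 2 (b, fderiv ℝ Φ xbar a) ∈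
        limitingNormalCone (WithLp.toLp 2 (Φ xbar, vbar)) (gph (subdiff θ)) := by
    intro a b
    have h := mem_coderivative_iff_of_solvesSystem (z := Φ xbar) hS
      (contDiffAt_lagrangianGradient hφ₀ hΦ vbar) (hΦ.of_le (by norm_num)) a b
    rwa [← hK0, sub_self, adjoint_fderiv_lagrangianGradient_inr hφ₀ hΦ,
      ← hessianXX_eq hφ₀ hΦ, adjoint_hessianXX hφ₀ hΦ] at h
  constructor
  · intro hLip ξ η h1 h2
    -- The sign comes from the `-v` in the coderivative: `η ∈ D^*∂θ(∇Φ ξ)` says that `(η, ∇Φ(-ξ))`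
    -- is normal to `gph ∂θ`.
    have h3 : WithLp.toLp 2 (-ξ, η) ∈ coderivative (kktSolutionMap φ₀ Φ θ)
        (WithLp.toLp 2 (0, 0)) (WithLp.toLp 2 (xbar, vbar)) 0 := by
      rw [hD, map_neg, map_neg]
      exact ⟨neg_eq_of_add_eq_zero_right h1, h2⟩
    have h4 := coderivative_zero_of_lipschitzLike hLip h3
    exact ⟨neg_eq_zero.1 (congrArg WithLp.fst h4), congrArg WithLp.snd h4⟩
  · intro hcond
    refine lipschitzLike_of_coderivative_zero (exists_isClosed_gph_kktSolutionMap_inter hφ₀ hΦ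
      (isClosed_gph_subdiff hθ hsol.2.1) _ _) fun u hu => ?_
    obtain ⟨h1, h2⟩ := (hD u.fst u.snd).1 hu
    have h3 := hcond (-u.fst) u.snd (by rw [map_neg, h1, neg_add_cancel]) (by
      change WithLp.toLp 2 (u.snd, -fderiv ℝ Φ xbar (-u.fst)) ∈ limitingNormalCone _ _
      rwa [map_neg, neg_neg])
    have h4 : u = WithLp.toLp 2 (u.fst, u.snd) := rfl
    rw [h4, neg_eq_zero.1 h3.1, h3.2]
    rfl
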